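/- Let $N\ge 1$, let $\lambda=(\lambda_1\ge\cdots\ge\lambda_N\ge 0)$ be a partition (with integer parts), and let $v\in\mathbb{C}$ and $z=(z_1,\ldots,z_N)\in\mathbb{C}^N$. Consider a rectangular lattice with $N$ rows, labeled $1,\ldots,N$ from bottom to top, and $\lambda_1+N$ columns, labeled $0,1,\ldots,\lambda_1+N-1$ from right to left. A state assigns a spin in $\{0,1\}$ to every edge (including the boundary edges) subject to the boundary conditions: $0$ on every left and every bottom boundary edge, $1$ on every right boundary edge, and on the top boundary $1$ in the columns labeled $\lambda_i+N-i$ $(1\le i\le N)$ and $0$ in all other columns. A vertex in row $i$ whose left, top, right and bottom edges carry the spins $(a,b,c,d)$ has the $\Gamma$-ice Boltzmann weight with spectral parameter $z_i$ and deformation parameter $v$: it equals $1$ for $(0,0,0,0)$, $z_i$ for $(1,1,1,1)$, $-v$ for $(0,1,0,1)$, $z_i$ for $(1,0,1,0)$, $z_i(1-v)$ for $(1,0,0,1)$, $1$ for $(0,1,1,0)$, and $0$ for all other spins. The weight of a state is the product of the weights of all its vertices, and the partition function $Z(\mathcal{S}_{\lambda,z})$ is the sum of the weights of all states. Then $$Z(\mathcal{S}_{\lambda,z})=\prod_{1\le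 i<j\le N}(z_j-v z_i)\; s_\lambda(z_1,\ldots,z_N),$$ where $s_\lambda$ is the Schur polynomial, i.e. the polynomial determined by $s_\lambda(x_1,\ldots,x_N)\prod_{1\le i<j\le N}(x_i-x_j)=\det\big(x_i^{\lambda_j+N-j}\big)_{1\le i,j\le N}$. -/

import Mathlib

open MvPolynomial

namespace GammaIce

/-! ### The six-vertex model

A spin is a `Bool`: `false` is the label `0` (a `+` spin) and `true` is the label `1` (a `-` spin). -/

/-- Boltzmann weight of a `Γ`-ice vertex with deformation parameter `v` and spectral parameter `z`,
as a function of the spins on its left, top, right and bottom edges. Apart from the six listed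
patterns `a₁, a₂, b₁, b₂, c₁, c₂` (in this order) a vertex is not admissible and has weight `0`. -/
def weight (v z : ℂ) : (left top right bottom : Bool) → ℂ
  | false, false, false, false => 1
  | true, true, true, true => z
  | false, true, false, true => -v
  | true, false, true, false => z
  | true, false, false, true => z * (1 - v)
  | false, true, true, false => 1
  | _, _, _, _ => 0

/-- A labelling by spins of the edges of the rectangular lattice with `N` rows and `M` columns.
Rows are numbered `0, …, N - 1` from bottom to top, columns `0, …, M - 1` from right to left. -/
abbrev Labelling (N M : ℕ) : Type :=
  (Fin N → Fin (M + 1) → Bool) × (Fin (N + 1) → Fin M → Bool)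

namespace Labelling

variable {N M : ℕ}

/-- The horizontal edges of row `i`, numbered `0, …, M` from right to left: edge `0` is on the right
boundary, edge `M` on the left boundary, and the vertex in column `c` lies between the edges `c`
(on its right) and `c + 1` (on its left). -/
def horiz (s : Labelling N M) (i : Fin N) (e : Fin (M + 1)) : Bool := s.1 i e

/-- The vertical edges of column `c`, numbered `0, …, N` from bottom to top: edge `0` is on the
bottom boundary, edge `N` on the top boundary, and the vertex in row `i` lies between the edges `i`
(below it) and `i + 1` (above it). -/
def vert (s : Labelling N M) (e : Fin (N + 1)) (c : Fin M) : Bool := s.2 e c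

/-- The Boltzmann weight of a labelling: the product of the weights of all vertices, where the
vertices in row `i` have spectral parameter `z i`. -/
def boltzmann (v : ℂ) (z : Fin N → ℂ) (s : Labelling N M) : ℂ :=
  ∏ i : Fin N, ∏ c : Fin M,
    weight v (z i) (s.horiz i c.succ) (s.vert i.succ c) (s.horiz i c.castSucc)
      (s.vert i.castSucc c)

/-- The boundary conditions given by `lam`: `0` on the left and the bottom, `1` on the right, and on
the top `1` exactly at the columns `lam_i + N - i`, `1 ≤ i ≤ N`. (With the index `i : Fin N`
starting at `0`, the last condition is `c = lam i + N - (i + 1)`.) -/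
def Boundary (lam : Fin N → ℕ) (s : Labelling N M) : Prop :=
  (∀ i : Fin N, s.horiz i (Fin.last M) = false) ∧
  (∀ i : Fin N, s.horiz i 0 = true) ∧
  (∀ c : Fin M, s.vert 0 c = false) ∧
  (∀ c : Fin M, s.vert (Fin.last N) c = true ↔ ∃ i : Fin N, (c : ℕ) + (i + 1) = lam i + N)

instance (lam : Fin N → ℕ) : DecidablePred (Boundary (M := M) lam) :=
  fun _ => inferInstanceAs (Decidable (_ ∧ _ ∧ _ ∧ _))

end Labelling

/-- The partition function of the `Γ`-ice model with `N` rows and `lam_1 + N` columns: the sum of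
the Boltzmann weights of all labellings that satisfy the boundary conditions. -/
def partitionFunction {N : ℕ} [NeZero N] (v : ℂ) (z : Fin N → ℂ) (lam : Fin N → ℕ) : ℂ :=
  ∑ s : Labelling N (lam 0 + N) with s.Boundary lam, s.boltzmann v z

end GammaIce

/-! ### Schur polynomials -/

namespace Schur

variable {N : ℕ}

/-- The alternant `det (x_i ^ (lam_j + N - j))`, with `1 ≤ i, j ≤ N`. -/
noncomputable def alternant (lam : Fin N → ℕ) : MvPolynomial (Fin N) ℤ :=
  Matrix.det (Matrix.of fun i j : Fin N =>
    (X i : MvPolynomial (Fin N) ℤ) ^ (lam j + (N - 1 - (j : ℕ))))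

/-- The Weyl denominator `∏_{i < j} (x_i - x_j)`. -/
noncomputable def denominator (N : ℕ) : MvPolynomial (Fin N) ℤ :=
  ∏ p : Fin N × Fin N with p.1 < p.2, (X p.1 - X p.2)

theorem irreducible_X_sub_X {i j : Fin N} (hij : i ≠ j) :
    Irreducible (X i - X j : MvPolynomial (Fin N) ℤ) := by
  have hc : coeff (Finsupp.single i 1) (X i - X j : MvPolynomial (Fin N) ℤ) = 1 := by
    rw [coeff_sub, coeff_X, coeff_X, if_pos rfl, if_neg, sub_zero]
    rw [Finsupp.single_left_inj one_ne_zero]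
    exact hij.symm
  refine irreducible_of_totalDegree_eq_one (le_antisymm ?_ ?_) ?_
  · refine (totalDegree_sub _ _).trans ?_
    simp
  · have h := le_totalDegree (p := (X i - X j : MvPolynomial (Fin N) ℤ))
      (s := Finsupp.single i 1) (by rw [mem_support_iff, hc]; exact one_ne_zero)
    simpa using h
  · intro x hx
    have := hx (Finsupp.single i 1)
    rw [hc] at this
    exact isUnit_of_dvd_one this

theorem X_sub_X_dvd_alternant (lam : Fin N → ℕ) {i j : Fin N} (hij : i ≠ j) :
    (X i - X j : MvPolynomial (Fin N) ℤ) ∣ alternant lam := by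
  rw [← Ideal.mem_span_singleton, ← Ideal.Quotient.eq_zero_iff_mem, alternant, RingHom.map_det]
  have h : Ideal.Quotient.mk (Ideal.span {(X i - X j : MvPolynomial (Fin N) ℤ)}) (X i)
      = Ideal.Quotient.mk _ (X j) := by
    rw [Ideal.Quotient.eq]
    exact Ideal.mem_span_singleton_self _
  refine Matrix.det_zero_of_row_eq hij ?_
  funext k
  simp [h]

theorem denominator_dvd_alternant (lam : Fin N → ℕ) : denominator N ∣ alternant lam := by
  refine Finset.prod_dvd_of_isRelPrime ?_ ?_
  · rintro ⟨i, j⟩ hp ⟨k, l⟩ hq hne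
    have hij : i < j := by simpa using hp
    have hkl : k < l := by simpa using hq
    refine (irreducible_X_sub_X hij.ne).isRelPrime_iff_not_dvd.2 ?_
    rintro ⟨q, h⟩
    have h2 := congrArg
      (MvPolynomial.eval fun t : Fin N => if t = i ∨ t = j then (0 : ℤ) else (t : ℕ) + 1) h
    simp only [map_sub, map_mul, eval_X, true_or, or_true, if_true, sub_zero, zero_mul] at h2
    have hne' : ¬ (i = k ∧ j = l) := fun hh => hne (by rw [hh.1, hh.2])
    split_ifs at h2 <;> omega
  · rintro ⟨i, j⟩ hp
    have hij : i < j := by simpa using hp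
    exact X_sub_X_dvd_alternant lam hij.ne

/-- The Schur polynomial `s_lam(x_1, …, x_N)`: the quotient of the alternant
`det (x_i ^ (lam_j + N - j))` by `∏_{i < j} (x_i - x_j)`. -/
noncomputable def schurPoly (lam : Fin N → ℕ) : MvPolynomial (Fin N) ℤ :=
  (denominator_dvd_alternant lam).choose

/-- The property that characterizes the Schur polynomial (`denominator N` is not a zero divisor). -/
theorem denominator_mul_schurPoly (lam : Fin N → ℕ) :
    denominator N * schurPoly lam = alternant lam :=
  (denominator_dvd_alternant lam).choose_spec.symm

theorem denominator_ne_zero (N : ℕ) : denominator N ≠ 0 := by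
  refine Finset.prod_ne_zero_iff.2 ?_
  rintro ⟨i, j⟩ hp
  have hij : i < j := by simpa using hp
  exact (irreducible_X_sub_X hij.ne).ne_zero

end Schur

/-! ### Determinants as functionals on an exterior algebra -/

namespace ExteriorAlgebra

/-! Encode a row of vertical spins as the wedge of the `X ^ c` over its occupied columns `c`. One
row of ice with parameter `w` then acts on the exterior algebra of `ℂ[X]`. Formally it is
contraction with evaluation at `w`, followed by multiplication of every factor by `(w - vX)/(w -
X)`; `mulFactors_rowSum` states this with the denominator cleared. `altEval` turns contraction into
Laplace expansion and multiplication of factors by `q` into the scalar `∏ q(z_i)`. So the top row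
`j` contributes `∏_{i<j} (z_j - v z_i)/(z_i - z_j)`, signs included, and induction on rows
(`topSum_mul_prod_sub`) leaves `det (z_i ^ (lam_j + N - j))`, the alternant. The factor `∏ (z_i -
z_j)` is cancelled where it is nonzero, a dense set, and continuity gives the rest. -/

theorem contractLeft_ιMulti {R M : Type*} [CommRing R] [AddCommGroup M] [Module R M]
    (d : Module.Dual R M) {n : ℕ} (m : Fin (n + 1) → M) :
    CliffordAlgebra.contractLeft d (ιMulti R (n + 1) m) =
      ∑ j : Fin (n + 1), ((-1) ^ (j : ℕ) * d (m j)) • ιMulti R n (m ∘ j.succAbove) := by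
  induction n with
  | zero => simp [Algebra.algebraMap_eq_smul_one]
  | succ n ih =>
    rw [ιMulti_succ_apply, CliffordAlgebra.contractLeft_ι_mul, ih, Fin.sum_univ_succ (n := n + 1),
      Finset.mul_sum, sub_eq_add_neg, ← Finset.sum_neg_distrib]
    simp only [Fin.val_zero, pow_zero, one_mul]
    congr 1
    refine Finset.sum_congr rfl fun j _ => ?_
    rw [ιMulti_succ_apply, mul_smul_comm, Fin.val_succ, pow_succ, ← neg_smul]
    congr 1
    · simp [Matrix.vecTail]
    · congr 2
      funext i
      simp [Matrix.vecTail]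

theorem contractLeft_map {R M N : Type*} [CommRing R] [AddCommGroup M] [Module R M]
    [AddCommGroup N] [Module R N] (d : Module.Dual R N) (f : M →ₗ[R] N)
    (x : ExteriorAlgebra R M) :
    CliffordAlgebra.contractLeft d (map f x) =
      map f (CliffordAlgebra.contractLeft (d ∘ₗ f) x) := by
  induction x using CliffordAlgebra.left_induction with
  | algebraMap r => simp [CliffordAlgebra.contractLeft_algebraMap]
  | add x y hx hy => simp [hx, hy]
  | ι_mul x m hx =>
    rw [map_mul, CliffordAlgebra.contractLeft_ι_mul, map_apply_ι,
      CliffordAlgebra.contractLeft_ι_mul, hx]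
    simp

section Polynomial

variable {R : Type*} [CommRing R]

/-- The functional on the exterior algebra of `R[X]` which sends `p_1 ∧ ⋯ ∧ p_n` to
`det (p_j (z_i))`. -/
noncomputable def altEval : (n : ℕ) → (Fin n → R) → (ExteriorAlgebra R (Polynomial R) →ₗ[R] R)
  | 0, _ => algebraMapInv.toLinearMap
  | n + 1, z => ((-1) ^ n : R) •
      (altEval n (Fin.init z) ∘ₗ CliffordAlgebra.contractLeft (Polynomial.leval (z (Fin.last n))))

/-- Laplace expansion along the last row: the factor `(-1) ^ n` in `altEval` turns the contraction
sign `(-1) ^ j` into the cofactor sign. -/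
theorem altEval_ιMulti {n : ℕ} (z : Fin n → R) (p : Fin n → Polynomial R) :
    altEval n z (ιMulti R n p) = (Matrix.of fun i j => (p j).eval (z i)).det := by
  induction n with
  | zero => simp [altEval]
  | succ n ih =>
    rw [altEval, LinearMap.smul_apply, LinearMap.comp_apply, contractLeft_ιMulti,
      Matrix.det_succ_row _ (Fin.last n), map_sum, Finset.smul_sum]
    refine Finset.sum_congr rfl fun j _ => ?_
    rw [map_smul, ih, smul_eq_mul, smul_eq_mul, pow_add, mul_assoc, mul_assoc, mul_assoc]
    congr 3
    simp only [Fin.succAbove_last]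
    congr 1

/-- The endomorphism of the exterior algebra of `R[X]` that multiplies every factor by `q`. -/
noncomputable def mulFactors (q : Polynomial R) :
    ExteriorAlgebra R (Polynomial R) →ₐ[R] ExteriorAlgebra R (Polynomial R) :=
  map (LinearMap.mulLeft R q)

@[simp]
theorem mulFactors_ι (q p : Polynomial R) : mulFactors q (ι R p) = ι R (q * p) := by
  simp [mulFactors]

theorem contractLeft_mulFactors (q : Polynomial R) (w : R)
    (x : ExteriorAlgebra R (Polynomial R)) :
    CliffordAlgebra.contractLeft (Polynomial.leval w) (mulFactors q x) =
      q.eval w • mulFactors q (CliffordAlgebra.contractLeft (Polynomial.leval w) x) := by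
  have h : Polynomial.leval w ∘ₗ LinearMap.mulLeft R q = q.eval w • Polynomial.leval w := by
    ext; simp
  rw [mulFactors, contractLeft_map, h]
  simp

/-- On a wedge, row `i` of the determinant is scaled by `q(z_i)`. -/
theorem altEval_mulFactors {n : ℕ} (z : Fin n → R) (q : Polynomial R)
    (x : ExteriorAlgebra R (Polynomial R)) :
    altEval n z (mulFactors q x) = (∏ i, q.eval (z i)) * altEval n z x := by
  induction n generalizing x with
  | zero =>
    have h : (algebraMapInv.comp (mulFactors q)) = algebraMapInv (R := R) := by
      ext; simp [algebraMapInv]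
    simpa [altEval] using DFunLike.congr_fun h x
  | succ n ih =>
    simp only [altEval, LinearMap.smul_apply, LinearMap.comp_apply, contractLeft_mulFactors,
      map_smul, ih, Fin.prod_univ_castSucc, smul_eq_mul, Fin.init]
    ring

end Polynomial

end ExteriorAlgebra

/-! ### One row of ice as an operator on the exterior algebra -/

namespace GammaIce

open ExteriorAlgebra

/-- The exterior product of the `X ^ c` over all columns `c` with spin `1`, from left to right. -/
noncomputable def wedge : (M : ℕ) → (Fin M → Bool) → ExteriorAlgebra ℂ (Polynomial ℂ)
  | 0, _ => 1
  | M + 1, t => (if t (Fin.last M) then ι ℂ (Polynomial.X ^ M) else 1) * wedge M (Fin.init t)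

/-- The sum over all states of one row with left spin `l`, right spin `1` and top spins `t` of the
Boltzmann weight times the exterior product of the bottom spins. -/
noncomputable def rowSum (v w : ℂ) :
    (M : ℕ) → Bool → (Fin M → Bool) → ExteriorAlgebra ℂ (Polynomial ℂ)
  | 0, l, _ => if l then 1 else 0
  | M + 1, l, t => ∑ b : Bool, ∑ r : Bool, weight v w l (t (Fin.last M)) r b •
      ((if b then ι ℂ (Polynomial.X ^ M) else 1) * rowSum v w M r (Fin.init t))

/-- Only the first identity is used later. The second makes the induction close, since removing the
leftmost column can leave either spin on the new left edge. -/
theorem mulFactors_rowSum (v w : ℂ) {M : ℕ} (t : Fin M → Bool) :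
    mulFactors (Polynomial.C w - Polynomial.X) (rowSum v w M false t) =
        mulFactors (Polynomial.C w - Polynomial.C v * Polynomial.X)
          (CliffordAlgebra.contractLeft (Polynomial.leval w) (wedge M t)) ∧
      mulFactors (Polynomial.C w - Polynomial.X) (rowSum v w M true t) =
        w ^ M • mulFactors (Polynomial.C w - Polynomial.C v * Polynomial.X) (wedge M t) -
          ((1 - v) * w) • (ι ℂ (Polynomial.X ^ M) *
            mulFactors (Polynomial.C w - Polynomial.C v * Polynomial.X)
              (CliffordAlgebra.contractLeft (Polynomial.leval w) (wedge M t))) := by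
  induction M with
  | zero => simp [rowSum, wedge, CliffordAlgebra.contractLeft_one]
  | succ M ih =>
    obtain ⟨h0, h1⟩ := ih (Fin.init t)
    -- Both multiplications send `X ^ M` into the span of `x = X ^ M` and `y = X ^ (M + 1)`, so each
    -- case becomes a linear identity in words in `x`, `y`, `B`, `K`.
    have e1 : (Polynomial.C w - Polynomial.X) * Polynomial.X ^ M =
        w • Polynomial.X ^ M - Polynomial.X ^ (M + 1) := by
      rw [Polynomial.smul_eq_C_mul]; ring
    have e2 : (Polynomial.C w - Polynomial.C v * Polynomial.X) * Polynomial.X ^ M =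
        w • Polynomial.X ^ M - v • Polynomial.X ^ (M + 1) := by
      rw [Polynomial.smul_eq_C_mul, Polynomial.smul_eq_C_mul]; ring
    generalize hx : ι ℂ (Polynomial.X ^ M : Polynomial ℂ) = x at *
    generalize hy : ι ℂ (Polynomial.X ^ (M + 1) : Polynomial ℂ) = y at *
    have hyy : y * y = 0 := by rw [← hy, ι_sq_zero]
    have hxx : x * x = 0 := by rw [← hx, ι_sq_zero]
    have k1 : mulFactors (Polynomial.C w - Polynomial.X) x = w • x - y := by
      rw [← hx, mulFactors_ι, e1, map_sub, map_smul, hx, hy]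
    have k2 : mulFactors (Polynomial.C w - Polynomial.C v * Polynomial.X) x = w • x - v • y := by
      rw [← hx, mulFactors_ι, e2, map_sub, map_smul, map_smul, hx, hy]
    have k3 (u : ExteriorAlgebra ℂ (Polynomial ℂ)) :
        CliffordAlgebra.contractLeft (Polynomial.leval w) (x * u) =
          w ^ M • u - x * CliffordAlgebra.contractLeft (Polynomial.leval w) u := by
      rw [← hx, CliffordAlgebra.contractLeft_ι_mul]; simp
    generalize hB : mulFactors (Polynomial.C w - Polynomial.C v * Polynomial.X)
      (wedge M (Fin.init t)) = B at *
    generalize hK : mulFactors (Polynomial.C w - Polynomial.C v * Polynomial.X)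
      (CliffordAlgebra.contractLeft (Polynomial.leval w) (wedge M (Fin.init t))) = K at *
    have a1 (u : ExteriorAlgebra ℂ (Polynomial ℂ)) : x * (x * u) = 0 := by
      rw [← mul_assoc, hxx, zero_mul]
    have a2 (u : ExteriorAlgebra ℂ (Polynomial ℂ)) : y * (y * u) = 0 := by
      rw [← mul_assoc, hyy, zero_mul]
    cases ht : t (Fin.last M)
    · simp only [rowSum, wedge, ht, Fintype.sum_bool, weight, map_add, map_smul, map_mul, h0, h1,
        hB, hK, k1, hx, if_true, if_false, one_mul, zero_smul, zero_add, add_zero,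
        one_smul, Bool.false_eq_true, true_and, sub_mul, smul_mul_assoc, mul_sub]
      module
    · simp only [rowSum, wedge, ht, Fintype.sum_bool, weight, map_add, map_sub, map_smul, map_mul,
        h0, h1, hB, hK, k1, k2, k3, hx, if_true, if_false, one_mul, zero_smul, zero_add, add_zero,
        one_smul, Bool.false_eq_true, sub_mul, smul_mul_assoc, mul_sub, mul_smul_comm,
        a1, a2]
      constructor <;> module

theorem prod_sub_mul_altEval_rowSum (v : ℂ) {n M : ℕ} (z : Fin (n + 1) → ℂ) (t : Fin M → Bool) :
    (∏ i : Fin n, (z i.castSucc - z (Fin.last n))) *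
        altEval n (Fin.init z) (rowSum v (z (Fin.last n)) M false t) =
      (∏ i : Fin n, (z (Fin.last n) - v * z i.castSucc)) * altEval (n + 1) z (wedge M t) := by
  have h := congrArg (altEval n (Fin.init z)) (mulFactors_rowSum v (z (Fin.last n)) t).1
  simp only [altEval_mulFactors, Polynomial.eval_sub, Polynomial.eval_C, Polynomial.eval_X,
    Polynomial.eval_mul, Fin.init] at h
  -- This sign cancels the `(-1) ^ n` in `altEval (n + 1)`.
  have hs : ∏ i : Fin n, (z i.castSucc - z (Fin.last n)) =
      (-1) ^ n * ∏ i : Fin n, (z (Fin.last n) - z i.castSucc) := by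
    rw [← Fin.prod_const, ← Finset.prod_mul_distrib]
    exact Finset.prod_congr rfl fun i _ => by ring
  rw [hs, mul_assoc]
  simp only [altEval, LinearMap.smul_apply, LinearMap.comp_apply, smul_eq_mul]
  rw [h]
  ring

/-! ### Row-by-row evaluation of the partition function -/

theorem sum_snoc {α β : Type*} [Fintype α] [AddCommMonoid β] {n : ℕ}
    (f : (Fin (n + 1) → α) → β) :
    ∑ h, f h = ∑ a : α, ∑ h : Fin n → α, f (Fin.snoc (α := fun _ => α) h a) := by
  rw [← (Fin.snocEquiv fun _ : Fin (n + 1) => α).sum_comp f, Fintype.sum_prod_type]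
  rfl

/-- The sum of the Boltzmann weights of the states of one row with left spin `l`, right spin `1`,
top spins `t` and bottom spins `b`. -/
def rowWeight (v w : ℂ) {M : ℕ} (l : Bool) (t b : Fin M → Bool) : ℂ :=
  ∑ h : Fin (M + 1) → Bool, if h (Fin.last M) = l ∧ h 0 = true then
    ∏ c : Fin M, weight v w (h c.succ) (t c) (h c.castSucc) (b c) else 0

theorem rowWeight_succ (v w : ℂ) {M : ℕ} (l : Bool) (t b : Fin (M + 1) → Bool) :
    rowWeight v w l t b = ∑ r : Bool, weight v w l (t (Fin.last M)) r (b (Fin.last M)) *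
      rowWeight v w r (Fin.init t) (Fin.init b) := by
  simp only [rowWeight, Finset.mul_sum]
  rw [sum_snoc, Finset.sum_comm, Finset.sum_comm (s := (Finset.univ : Finset Bool))]
  refine Finset.sum_congr rfl fun h _ => ?_
  have h0 (a : Bool) : Fin.snoc (α := fun _ => Bool) h a 0 = h 0 :=
    Fin.snoc_castSucc (α := fun _ => Bool) a h 0
  simp only [Fin.snoc_last, h0, Fin.prod_univ_castSucc, Fin.succ_last, Fin.snoc_castSucc,
    Fin.succ_castSucc, Fin.init, ite_and, Finset.sum_ite_eq', Finset.sum_ite_eq, Finset.mem_univ,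
    if_true, mul_ite, mul_zero]
  split_ifs
  · rw [mul_comm]
  · rfl

theorem rowSum_eq_sum_rowWeight (v w : ℂ) {M : ℕ} (l : Bool) (t : Fin M → Bool) :
    rowSum v w M l t = ∑ b, rowWeight v w l t b • wedge M b := by
  induction M generalizing l with
  | zero =>
    -- Without columns the left and right boundary edges coincide, so only `l = true` contributes.
    rw [Fintype.sum_unique, rowWeight, sum_snoc]
    cases l <;> simp [rowSum, wedge, Fin.snoc]
  | succ M ih =>
    rw [rowSum, sum_snoc]
    refine Finset.sum_congr rfl fun b _ => ?_
    simp only [rowWeight_succ, wedge, Fin.snoc_last, Fin.init_snoc, Finset.sum_smul, ih,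
      Finset.mul_sum, Finset.smul_sum]
    rw [Finset.sum_comm]
    refine Finset.sum_congr rfl fun b' _ => Finset.sum_congr rfl fun r _ => ?_
    rw [mul_smul_comm, smul_smul]

/-- The partition function of the model with arbitrary top spins `t`. -/
def topSum (v : ℂ) {n M : ℕ} (z : Fin n → ℂ) (t : Fin M → Bool) : ℂ :=
  ∑ f : Fin n → Fin (M + 1) → Bool, ∑ g : Fin (n + 1) → Fin M → Bool,
    if g (Fin.last n) = t ∧ g 0 = (fun _ => false) ∧
        ∀ i, f i (Fin.last M) = false ∧ f i 0 = true then
      Labelling.boltzmann v z (f, g) else 0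

theorem boltzmann_snoc (v : ℂ) {n M : ℕ} (z : Fin (n + 1) → ℂ)
    (f : Fin n → Fin (M + 1) → Bool) (h : Fin (M + 1) → Bool)
    (g : Fin (n + 1) → Fin M → Bool) (t : Fin M → Bool) :
    Labelling.boltzmann v z (Fin.snoc (α := fun _ => Fin (M + 1) → Bool) f h,
        Fin.snoc (α := fun _ => Fin M → Bool) g t) =
      (∏ c : Fin M, weight v (z (Fin.last n)) (h c.succ) (t c) (h c.castSucc) (g (Fin.last n) c)) *
        Labelling.boltzmann v (Fin.init z) (f, g) := by
  simp only [Labelling.boltzmann, Labelling.horiz, Labelling.vert, Fin.prod_univ_castSucc (n := n),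
    Fin.snoc_last, Fin.snoc_castSucc, Fin.succ_castSucc, Fin.succ_last, Fin.init]
  rw [mul_comm]

/-- Transfer matrix step: the lattice is cut below its top row, and `b` is the spin pattern on the
cut. -/
theorem topSum_succ (v : ℂ) {n M : ℕ} (z : Fin (n + 1) → ℂ) (t : Fin M → Bool) :
    topSum v z t =
      ∑ b, rowWeight v (z (Fin.last n)) false t b * topSum v (Fin.init z) b := by
  -- Each term is a sum over glued labellings with the cut forced to equal `b`; summing over `b`
  -- then removes the constraint.
  have hR (b : Fin M → Bool) :
      rowWeight v (z (Fin.last n)) false t b * topSum v (Fin.init z) b =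
        ∑ h : Fin (M + 1) → Bool, ∑ f : Fin n → Fin (M + 1) → Bool,
          ∑ g : Fin (n + 1) → Fin M → Bool, if g (Fin.last n) = b then
            (if (h (Fin.last M) = false ∧ h 0 = true) ∧ g 0 = (fun _ => false) ∧
                ∀ i, f i (Fin.last M) = false ∧ f i 0 = true then
              Labelling.boltzmann v z (Fin.snoc (α := fun _ => Fin (M + 1) → Bool) f h,
                Fin.snoc (α := fun _ => Fin M → Bool) g t) else 0) else 0 := by
    rw [rowWeight, topSum, Finset.sum_mul]
    refine Finset.sum_congr rfl fun h _ => ?_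
    rw [Finset.mul_sum]
    refine Finset.sum_congr rfl fun f _ => ?_
    rw [Finset.mul_sum]
    refine Finset.sum_congr rfl fun g _ => ?_
    rw [boltzmann_snoc]
    by_cases hb : g (Fin.last n) = b
    · simp only [hb, true_and, if_true, ite_and (h (Fin.last M) = false ∧ h 0 = true), ite_mul,
        mul_ite, mul_zero, zero_mul]
      split_ifs <;> rfl
    · simp [hb]
  simp only [hR]
  rw [topSum, sum_snoc, Finset.sum_comm (s := (Finset.univ : Finset (Fin M → Bool)))]
  refine Finset.sum_congr rfl fun h _ => ?_
  rw [Finset.sum_comm (s := (Finset.univ : Finset (Fin M → Bool)))]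
  refine Finset.sum_congr rfl fun f _ => ?_
  rw [Finset.sum_comm (s := (Finset.univ : Finset (Fin M → Bool))), sum_snoc, Finset.sum_comm]
  refine Finset.sum_congr rfl fun g _ => ?_
  have h0 (a : Fin M → Bool) : Fin.snoc (α := fun _ => Fin M → Bool) g a 0 = g 0 :=
    Fin.snoc_castSucc (α := fun _ => Fin M → Bool) a g 0
  simp only [Finset.sum_ite_eq, Finset.mem_univ, if_true, Fin.snoc_last, h0, Fin.forall_fin_succ',
    Fin.snoc_castSucc]
  rw [Finset.sum_congr rfl fun a _ => ite_and (a = t) _ _ _, Finset.sum_ite_eq']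
  simp only [Finset.mem_univ, if_true]
  refine if_congr ?_ rfl rfl
  tauto

/-- Without rows the top edges are the bottom edges, which carry `0`. -/
theorem topSum_zero (v : ℂ) {M : ℕ} (z : Fin 0 → ℂ) (t : Fin M → Bool) :
    topSum v z t = if (fun _ => false) = t then 1 else 0 := by
  rw [topSum, Fintype.sum_unique, sum_snoc]
  have h0 (h : Fin 0 → Fin M → Bool) (a : Fin M → Bool) :
      Fin.snoc (α := fun _ => Fin M → Bool) h a 0 = a :=
    Fin.snoc_last (α := fun _ => Fin M → Bool) a h
  simp only [Labelling.boltzmann, Fintype.sum_unique, Fin.snoc_last, Finset.univ_eq_empty,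
    Finset.prod_empty, h0, IsEmpty.forall_iff, and_true, ite_and]
  rw [Finset.sum_ite_eq']
  simp [eq_comm]

/-- The scalar part of a wedge vanishes unless the wedge is empty; this matches `topSum_zero` in the
base case of the induction on rows. -/
theorem algebraMapInv_wedge {M : ℕ} (t : Fin M → Bool) :
    algebraMapInv (wedge M t) = if (fun _ => false) = t then (1 : ℂ) else 0 := by
  induction M with
  | zero => simp [wedge, Subsingleton.elim (fun _ => false) t]
  | succ M ih =>
    rw [wedge, map_mul, ih]
    have h : ((fun _ => false) = t) ↔ t (Fin.last M) = false ∧ (fun _ => false) = Fin.init t := by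
      simp only [funext_iff, Fin.forall_fin_succ', Fin.init]
      rw [and_comm, eq_comm (a := false) (b := t _)]
    simp only [h]
    cases t (Fin.last M) <;> simp [algebraMapInv]

theorem prod_lt_castSucc {n : ℕ} (f : Fin (n + 1) → Fin (n + 1) → ℂ) :
    ∏ p : Fin (n + 1) × Fin (n + 1) with p.1 < p.2, f p.1 p.2 =
      (∏ p : Fin n × Fin n with p.1 < p.2, f p.1.castSucc p.2.castSucc) *
        ∏ i : Fin n, f i.castSucc (Fin.last n) := by
  have hl (i : Fin (n + 1)) : ¬ Fin.last n < i := (Fin.le_last i).not_gt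
  simp [Finset.prod_filter, Fintype.prod_prod_type, Fin.prod_univ_castSucc, Fin.castSucc_lt_last,
    hl, Finset.prod_mul_distrib]

theorem topSum_mul_prod_sub (v : ℂ) {n M : ℕ} (z : Fin n → ℂ) (t : Fin M → Bool) :
    (∏ p : Fin n × Fin n with p.1 < p.2, (z p.1 - z p.2)) * topSum v z t =
      (∏ p : Fin n × Fin n with p.1 < p.2, (z p.2 - v * z p.1)) * altEval n z (wedge M t) := by
  induction n generalizing t with
  | zero => simp [topSum_zero, altEval, algebraMapInv_wedge]
  | succ n ih =>
    rw [prod_lt_castSucc fun i j => z i - z j, prod_lt_castSucc fun i j => z j - v * z i,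
      mul_assoc (∏ p : Fin n × Fin n with p.1 < p.2, (z p.2.castSucc - v * z p.1.castSucc)),
      ← prod_sub_mul_altEval_rowSum, rowSum_eq_sum_rowWeight, topSum_succ, map_sum]
    simp only [map_smul, smul_eq_mul, Finset.mul_sum]
    refine Finset.sum_congr rfl fun b _ => ?_
    have h := ih (Fin.init z) b
    simp only [Fin.init] at h ⊢
    linear_combination
      (∏ i : Fin n, (z i.castSucc - z (Fin.last n))) * rowWeight v (z (Fin.last n)) false t b * h

/-! ### Comparison with the Schur polynomial -/

theorem wedge_eq_ιMulti {n M : ℕ} (l : Fin n → ℕ) (hl : StrictAnti l) (hM : ∀ i, l i < M)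
    (t : Fin M → Bool) (ht : ∀ c, t c = true ↔ ∃ i, (c : ℕ) = l i) :
    wedge M t = ιMulti ℂ n fun i => Polynomial.X ^ l i := by
  induction M generalizing n with
  | zero =>
    cases n with
    | zero => simp [wedge]
    | succ n => exact absurd (hM 0) (Nat.not_lt_zero _)
  | succ M ih =>
    rw [wedge]
    by_cases hlast : ∃ i, M = l i
    · obtain ⟨i, hi⟩ := hlast
      cases n with
      | zero => exact i.elim0
      | succ n =>
        -- An occupied leftmost column must be the largest exponent, hence the first factor.
        have h0 : l 0 = M := by
          have := hl.antitone (Fin.zero_le i)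
          have := hM 0
          omega
        rw [if_pos ((ht _).2 ⟨0, by simp [h0]⟩), ιMulti_succ_apply, h0,
          ih (fun i => l i.succ) (fun i j h => hl (Fin.succ_lt_succ_iff.2 h))
            (fun i => h0 ▸ hl (Fin.succ_pos i))]
        · rfl
        · intro c
          rw [Fin.init, ht, Fin.exists_fin_succ, h0]
          simp [c.2.ne]
    · rw [if_neg (by rw [ht]; simpa using hlast), one_mul, ih l hl]
      · intro i
        have := hM i
        have : M ≠ l i := fun h => hlast ⟨i, h⟩
        omega
      · intro c
        rw [Fin.init, ht]
        simp

theorem continuous_partitionFunction {N : ℕ} [NeZero N] (v : ℂ) (lam : Fin N → ℕ) :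
    Continuous fun z : Fin N → ℂ => partitionFunction v z lam := by
  have hw (l t r b : Bool) : Continuous fun w : ℂ => weight v w l t r b := by
    cases l <;> cases t <;> cases r <;> cases b <;> simp only [weight] <;> fun_prop
  unfold partitionFunction Labelling.boltzmann
  exact continuous_finsetSum _ fun s _ => continuous_finsetProd _ fun i _ =>
    continuous_finsetProd _ fun c _ => (hw _ _ _ _).comp (continuous_apply i)

theorem partitionFunction_eq_topSum {N : ℕ} [NeZero N] (v : ℂ) (z : Fin N → ℂ) (lam : Fin N → ℕ) :
    partitionFunction v z lam = topSum v z fun c : Fin (lam 0 + N) =>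
      decide (∃ i : Fin N, (c : ℕ) + (i + 1) = lam i + N) := by
  rw [partitionFunction, Finset.sum_filter, Fintype.sum_prod_type, topSum]
  refine Finset.sum_congr rfl fun f _ => Finset.sum_congr rfl fun g _ => if_congr ?_ rfl rfl
  simp only [Labelling.Boundary, Labelling.horiz, Labelling.vert, funext_iff, forall_and,
    Bool.eq_iff_iff (b := decide _), decide_eq_true_eq]
  tauto

theorem prod_sub_mul_partitionFunction {N : ℕ} [NeZero N] (lam : Fin N → ℕ) (hlam : Antitone lam)
    (v : ℂ) (z : Fin N → ℂ) :
    (∏ p : Fin N × Fin N with p.1 < p.2, (z p.1 - z p.2)) * partitionFunction v z lam =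
      (∏ p : Fin N × Fin N with p.1 < p.2, (z p.1 - z p.2)) *
        ((∏ p : Fin N × Fin N with p.1 < p.2, (z p.2 - v * z p.1)) *
          aeval z (Schur.schurPoly lam)) := by
  have hS := congrArg (aeval z) (Schur.denominator_mul_schurPoly lam)
  rw [map_mul, Schur.denominator, Schur.alternant, map_prod, AlgHom.map_det] at hS
  simp only [map_sub, aeval_X] at hS
  rw [partitionFunction_eq_topSum, topSum_mul_prod_sub,
    wedge_eq_ιMulti (fun i => lam i + (N - 1 - i)), altEval_ιMulti, mul_left_comm, hS]
  · congr 2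
    ext i j
    simp
  · intro i j hij
    have := hlam hij.le
    have := j.2
    have : (i : ℕ) < j := hij
    dsimp only
    omega
  · intro i
    have := hlam (Fin.zero_le i)
    have := i.2
    omega
  · intro c
    rw [decide_eq_true_eq]
    refine exists_congr fun i => ?_
    have := i.2
    omega

/-- Move `z` along the direction `(0, 1, …, N - 1)`: two given coordinates meet for at most one
value of `s`, so all sufficiently small nonzero `s` give distinct coordinates. -/
theorem dense_prod_sub_ne_zero (N : ℕ) :
    Dense {z : Fin N → ℂ | ∏ p : Fin N × Fin N with p.1 < p.2, (z p.1 - z p.2) ≠ 0} := by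
  intro z
  have hc : Continuous fun (s : ℂ) (i : Fin N) => z i + s * (i : ℕ) := by fun_prop
  have hz : (fun i : Fin N => z i + (0 : ℂ) * (i : ℕ)) = z := by simp
  have ht : Filter.Tendsto (fun (s : ℂ) (i : Fin N) => z i + s * (i : ℕ))
      (nhdsWithin 0 {0}ᶜ) (nhds z) := by
    have := (hc.tendsto 0).mono_left (nhdsWithin_le_nhds (s := {0}ᶜ))
    rwa [hz] at this
  refine mem_closure_of_tendsto ht ?_
  simp only [Set.mem_ofPred_eq, Finset.prod_ne_zero_iff, Finset.mem_filter_univ]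
  rw [Filter.eventually_all]
  rintro ⟨i, j⟩
  rw [Filter.eventually_imp_distrib_left]
  intro hij
  have hij' : ((i : ℕ) : ℂ) - (j : ℕ) ≠ 0 := by
    rw [sub_ne_zero]
    exact_mod_cast (Fin.lt_def.1 hij).ne
  have hfin : {s : ℂ | z i + s * (i : ℕ) - (z j + s * (j : ℕ)) = 0}.Finite := by
    refine (Set.finite_singleton ((z j - z i) / ((i : ℕ) - (j : ℕ)))).subset fun s hs => ?_
    rw [Set.mem_ofPred_eq] at hs
    rw [Set.mem_singleton_iff, eq_div_iff hij']
    linear_combination hs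
  exact nhdsNE_le_cofinite 0 hfin.compl_mem_cofinite

end GammaIce

theorem theorem1 {N : ℕ} [NeZero N] (lam : Fin N → ℕ) (hlam : Antitone lam)
    (v : ℂ) (z : Fin N → ℂ) :
    GammaIce.partitionFunction v z lam =
      (∏ p : Fin N × Fin N with p.1 < p.2, (z p.2 - v * z p.1)) *
        MvPolynomial.aeval z (Schur.schurPoly lam) := by
  have hc : Continuous fun z : Fin N → ℂ =>
      (∏ p : Fin N × Fin N with p.1 < p.2, (z p.2 - v * z p.1)) *
        MvPolynomial.aeval z (Schur.schurPoly lam) := by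
    have h : Continuous fun z : Fin N → ℂ => MvPolynomial.aeval z (Schur.schurPoly lam) := by
      simp only [MvPolynomial.aeval_def, ← MvPolynomial.eval_map]
      exact MvPolynomial.continuous_eval _
    fun_prop
  refine congrFun (Continuous.ext_on (GammaIce.dense_prod_sub_ne_zero N)
    (GammaIce.continuous_partitionFunction v lam) hc fun y hy => ?_) z
  exact mul_left_cancel₀ hy (GammaIce.prod_sub_mul_partitionFunction lam hlam v y)
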